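/- Let $m,t$ and $k_1,\dots,k_m$ be positive integers. For $1\le i\le m$ and $1\le j\le k_i$ let $S_{ij}\subseteq\mathbb N=\{0,1,2,\dots\}$ be a finite set with $0\in S_{ij}$ and $|S_{ij}|\le t$. Call a probability density $\varphi$ on $\mathbb R$ convenient if it is symmetric, $\varphi(-u)=\varphi(u)$ for all $u\in\mathbb R$, monotonically decreasing (not necessarily strictly) on $(0,\infty)$, and $\int_{\mathbb R}|u|\varphi(u)\,du<\infty$. For all $i,j$ and $s\in S_{ij}$ let $\varphi_{ijs}$ be a convenient density, and let $A,B$ be real constants such that $\|\varphi_{ijs}\|_\infty\le A$ and $\int_{\mathbb R}|u|\varphi_{ijs}(u)\,du\le B$ for all $i,j,s$. Let $u_{ijs}$ ($1\le i\le m$, $1\le j\le k_i$, $s\in S_{ij}$) be independent real random variables such that $u_{ijs}$ has density $\varphi_{ijs}$, and put $$f_{ij}(x)=\sum_{s\in S_{ij}}u_{ijs}x^s,\qquad F(x)=\sum_{i=1}^m f_{i1}(x)\cdots f_{ik_i}(x).$$ Then the number of distinct zeros $\#\{x\in[0,1]:F(x)=0\}$ is a random variable with values in $\{0,1,2,\dots\}\cup\{\infty\}$,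 and its expectation satisfies $$\mathbb E\,\#\{x\in[0,1]:F(x)=0\}\ \le\ AB\,(k_1+\dots+k_m)(t-1).$$ -/

import Mathlib

open MeasureTheory ProbabilityTheory
open scoped ENNReal Polynomial

/-- A convenient probability density on the real line: a probability density that is symmetric
around the origin, (weakly) decreasing on the positive half-line, and has a finite first absolute
moment. -/
structure IsConvenientDensity (φ : ℝ → ℝ) : Prop where
  measurable : Measurable φ
  nonneg : ∀ u, 0 ≤ φ u
  lintegral_eq_one : ∫⁻ u, ENNReal.ofReal (φ u) = 1
  symmetric : ∀ u, φ (-u) = φ u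
  antitoneOn : AntitoneOn φ (Set.Ioi 0)
  integrable_abs_mul : Integrable (fun u : ℝ => |u| * φ u)

/-- The first absolute moment of a density. -/
noncomputable def absMoment (φ : ℝ → ℝ) : ℝ := ∫ u, |u| * φ u

/-- The index set of all coefficients: triples `(i, j, s)` with `s` in the support `S i j`. -/
abbrev CoeffIndex {m : ℕ} {k : Fin m → ℕ} (S : (i : Fin m) → Fin (k i) → Finset ℕ) : Type :=
  Σ i : Fin m, Σ j : Fin (k i), {s : ℕ // s ∈ S i j}

/-- The sparse polynomial `f_{ij}(x) = ∑_{s ∈ S_{ij}} c_{ijs} x^s`. -/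
noncomputable def sparsePoly {m : ℕ} {k : Fin m → ℕ} (S : (i : Fin m) → Fin (k i) → Finset ℕ)
    (c : CoeffIndex S → ℝ) (i : Fin m) (j : Fin (k i)) : ℝ[X] :=
  ∑ s : {s : ℕ // s ∈ S i j}, Polynomial.C (c ⟨i, j, s⟩) * Polynomial.X ^ (s : ℕ)

/-- The sum of products of sparse polynomials `F = ∑ i, ∏ j, f_{ij}`. -/
noncomputable def sumProdSparse {m : ℕ} {k : Fin m → ℕ} (S : (i : Fin m) → Fin (k i) → Finset ℕ)
    (c : CoeffIndex S → ℝ) : ℝ[X] :=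
  ∑ i : Fin m, ∏ j : Fin (k i), sparsePoly S c i j

/-- The number of distinct zeros of `p` in the closed interval `[0, 1]`, with value `∞` if there are
infinitely many. -/
noncomputable def numZerosUnit (p : ℝ[X]) : ℝ≥0∞ :=
  (({x : ℝ | x ∈ Set.Icc (0 : ℝ) 1 ∧ p.eval x = 0}.encard : ℕ∞) : ℝ≥0∞)

/-! Kac's method. If a polynomial `p` is nonzero at 0 and 1, each zero has a neighbourhood on which
`|p|` climbs from 0 to `ε` on both sides, so for small `ε` the integral of `|p'|` over `{|p| < ε}`
is at least `2ε` per distinct zero (`numZerosUnit_le_liminf`). Fatou's lemma then reduces the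
theorem to bounding the expected integral by `2ε` times the claimed constant, for every `ε > 0`.

By the product rule `F'` is the sum of the terms `cofactor * f_ij'`. At fixed `x`, treat each term
by integrating over the constant coefficient of its own `f_ij`, which exists because `0 ∈ S i j`.
Neither the cofactor nor `f_ij'` involves this coefficient, while `F` is affine in it with the
cofactor as slope. A density bounded by `A` gives `|F(x)| < ε` conditional probability at most `2εA
/ |cofactor|`, and the cofactor cancels (`lintegral_indicator_abs_affine_lt_le`). What remains is
`A` times the expectation of `|f_ij'(x)|`, at most `B` times the sum of `s x^(s-1)`. Over `[0,1]`
each nonzero `s` contributes 1, giving `AB(t-1)` for each of the `∑ k i` factors. -/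

/-! ### Measurability of the number of zeros. -/

open Filter Topology in
theorem exists_nat_injOn_floor_mul {T : Set ℝ} (hT : T.Finite) (h0 : ∀ x ∈ T, 0 ≤ x) :
    ∃ n : ℕ, Set.InjOn (fun x : ℝ => ⌊(n : ℝ) * x⌋₊) T := by
  have key : ∀ x ∈ T, ∀ y ∈ T, ∀ᶠ n : ℕ in atTop,
      x < y → ⌊(n : ℝ) * x⌋₊ < ⌊(n : ℝ) * y⌋₊ := by
    intro x hx y hy
    by_cases hxy : x < y
    · have hlim : Tendsto (fun n : ℕ => (n : ℝ) * (y - x)) atTop atTop :=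
        tendsto_natCast_atTop_atTop.atTop_mul_const (sub_pos.2 hxy)
      filter_upwards [hlim.eventually_ge_atTop 1] with n hn _
      have h1 : (n : ℝ) * x + 1 ≤ n * y := by linarith
      have h2 : ⌊(n : ℝ) * x + 1⌋₊ = ⌊(n : ℝ) * x⌋₊ + 1 :=
        Nat.floor_add_one (mul_nonneg n.cast_nonneg (h0 x hx))
      have := Nat.floor_le_floor h1
      omega
    · exact Eventually.of_forall fun n h => absurd h hxy
  have := (eventually_all_finite hT).2 fun x hx => (eventually_all_finite hT).2 (key x hx)
  obtain ⟨n, hn⟩ := this.exists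
  refine ⟨n, fun x hx y hy hxy => ?_⟩
  by_contra hne
  rcases lt_or_gt_of_ne hne with h | h
  · exact (hn x hx y hy h).ne hxy
  · exact (hn y hy x hx h).ne hxy.symm

/-- Counts points by occupied cells of mesh `1/n`: a fine enough mesh separates any given finite
subset. This writes the zero count through countably many events "some zero lies in this cell". -/
theorem encard_eq_iSup_encard_floor_image {Z : Set ℝ} (h0 : ∀ x ∈ Z, 0 ≤ x) :
    Z.encard = ⨆ n : ℕ, ((fun x : ℝ => ⌊(n : ℝ) * x⌋₊) '' Z).encard := by
  apply le_antisymm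
  -- Testing against natural numbers reduces to finite subsets, so infinite `Z` is covered too.
  · refine ENat.forall_natCast_le_iff_le.1 fun a ha => ?_
    obtain ⟨T, hTZ, hT⟩ := Set.exists_subset_encard_eq ha
    have hTfin : T.Finite := Set.finite_of_encard_eq_coe hT
    obtain ⟨n, hn⟩ := exists_nat_injOn_floor_mul hTfin fun x hx => h0 x (hTZ hx)
    rw [← hT, ← hn.encard_image]
    exact (Set.encard_le_encard (Set.image_mono hTZ)).trans
      (le_iSup (fun n : ℕ => ((fun x : ℝ => ⌊(n : ℝ) * x⌋₊) '' Z).encard) n)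
  · exact iSup_le fun n => Set.encard_image_le _ _

-- The endpoint `x = 1` falls into cell `n`, hence `n + 1` cells.
open Classical in
theorem encard_floor_image_eq_sum {Z : Set ℝ} (hZ : Z ⊆ Set.Icc 0 1) (n : ℕ) :
    ((((fun x : ℝ => ⌊(n : ℝ) * x⌋₊) '' Z).encard : ℕ∞) : ℝ≥0∞) =
      ∑ k ∈ Finset.range (n + 1), if ∃ x ∈ Z, ⌊(n : ℝ) * x⌋₊ = k then 1 else 0 := by
  have : (fun x : ℝ => ⌊(n : ℝ) * x⌋₊) '' Z =
      ↑((Finset.range (n + 1)).filter fun k => ∃ x ∈ Z, ⌊(n : ℝ) * x⌋₊ = k) := by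
    ext k
    simp only [Set.mem_image, Finset.coe_filter, Finset.mem_range, Set.mem_ofPred_eq]
    refine ⟨fun h => ⟨?_, h⟩, fun h => h.2⟩
    obtain ⟨x, hx, rfl⟩ := h
    have hx1 := (hZ hx).2
    have : (n : ℝ) * x ≤ n := mul_le_of_le_one_right n.cast_nonneg hx1
    exact Nat.lt_succ_of_le (Nat.floor_le_of_le this)
  rw [this, Set.encard_coe_eq_coe_finsetCard, Finset.card_filter]
  push_cast
  simp

/-- The set is the projection of a closed set along a compact factor. The floor cells are half-open,
so a σ-compact version is needed afterwards. -/
theorem isClosed_setOf_exists_mem_eq_zero {X : Type*} [TopologicalSpace X] {F : X → ℝ → ℝ}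
    (hF : Continuous (Function.uncurry F)) {K : Set ℝ} (hK : IsCompact K) :
    IsClosed {c | ∃ x ∈ K, F c x = 0} := by
  have := isCompact_iff_compactSpace.1 hK
  have hcl : IsClosed {z : K × X | F z.2 z.1 = 0} :=
    isClosed_eq (hF.comp (continuous_snd.prodMk (continuous_subtype_val.comp continuous_fst)))
      continuous_const
  have := isClosedMap_snd_of_compactSpace _ hcl
  convert this using 1
  ext c
  simp

theorem measurableSet_setOf_exists_mem_eq_zero {X : Type*} [TopologicalSpace X]
    [MeasurableSpace X] [OpensMeasurableSpace X] {F : X → ℝ → ℝ}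
    (hF : Continuous (Function.uncurry F)) {K : Set ℝ} (hK : IsSigmaCompact K) :
    MeasurableSet {c | ∃ x ∈ K, F c x = 0} := by
  obtain ⟨C, hC, rfl⟩ := hK
  have : {c | ∃ x ∈ ⋃ n, C n, F c x = 0} = ⋃ n, {c | ∃ x ∈ C n, F c x = 0} := by
    ext c
    simp only [Set.mem_iUnion, Set.mem_ofPred_eq]
    constructor
    · rintro ⟨x, ⟨n, hn⟩, hx⟩
      exact ⟨n, x, hn, hx⟩
    · rintro ⟨n, x, hn, hx⟩
      exact ⟨x, ⟨n, hn⟩, hx⟩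
  rw [this]
  exact MeasurableSet.iUnion fun n => (isClosed_setOf_exists_mem_eq_zero hF (hC n)).measurableSet

theorem isSigmaCompact_Ico (a b : ℝ) : IsSigmaCompact (Set.Ico a b) := by
  refine ⟨fun n : ℕ => Set.Icc a (b - 1 / ((n : ℝ) + 1)), fun n => isCompact_Icc, ?_⟩
  ext x
  simp only [Set.mem_iUnion, Set.mem_Icc, Set.mem_Ico]
  constructor
  · rintro ⟨n, h1, h2⟩
    have : (0 : ℝ) < 1 / ((n : ℝ) + 1) := by positivity
    exact ⟨h1, by linarith⟩
  · rintro ⟨h1, h2⟩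
    obtain ⟨n, hn⟩ := exists_nat_one_div_lt (sub_pos.2 h2)
    exact ⟨n, h1, by linarith⟩

theorem isSigmaCompact_unitInterval_inter_floor_fiber (n k : ℕ) :
    IsSigmaCompact {x : ℝ | x ∈ Set.Icc (0 : ℝ) 1 ∧ ⌊(n : ℝ) * x⌋₊ = k} := by
  rcases Nat.eq_zero_or_pos n with rfl | hn
  · by_cases hk : k = 0
    · simpa [hk, Set.Icc_def] using (isCompact_Icc (a := (0 : ℝ)) (b := 1)).isSigmaCompact
    · simp [Ne.symm hk]
  · have hn' : (0 : ℝ) < n := Nat.cast_pos.2 hn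
    have : {x : ℝ | x ∈ Set.Icc (0 : ℝ) 1 ∧ ⌊(n : ℝ) * x⌋₊ = k} =
        Set.Icc (0 : ℝ) 1 ∩ Set.Ico ((k : ℝ) / n) ((k + 1) / n) := by
      ext x
      simp only [Set.mem_ofPred_eq, Set.mem_inter_iff]
      refine and_congr_right fun hx => ?_
      rw [Nat.floor_eq_iff (mul_nonneg hn'.le hx.1), Set.mem_Ico, div_le_iff₀ hn',
        lt_div_iff₀ hn', mul_comm x]
    rw [this, Set.inter_comm]
    obtain ⟨C, hC, hCU⟩ := isSigmaCompact_Ico ((k : ℝ) / n) ((k + 1) / n)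
    refine ⟨fun j => C j ∩ Set.Icc 0 1, fun j => (hC j).inter_right isClosed_Icc, ?_⟩
    rw [← Set.iUnion_inter, hCU]

theorem measurable_numZerosUnit {X : Type*} [TopologicalSpace X] [MeasurableSpace X]
    [OpensMeasurableSpace X] {p : X → ℝ[X]}
    (hp : Continuous (Function.uncurry fun c x => (p c).eval x)) :
    Measurable fun c => numZerosUnit (p c) := by
  classical
  have hEq : ∀ c, numZerosUnit (p c) = ⨆ n : ℕ, ∑ k ∈ Finset.range (n + 1),
      if ∃ x ∈ {x : ℝ | x ∈ Set.Icc (0 : ℝ) 1 ∧ (p c).eval x = 0}, ⌊(n : ℝ) * x⌋₊ = k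
        then 1 else 0 := by
    intro c
    rw [numZerosUnit, encard_eq_iSup_encard_floor_image fun x hx => hx.1.1, ENat.toENNReal_iSup]
    exact iSup_congr fun n => encard_floor_image_eq_sum (fun x hx => hx.1) n
  simp_rw [hEq]
  refine Measurable.iSup fun n => Finset.measurable_sum _ fun k _ => ?_
  refine Measurable.ite ?_ measurable_const measurable_const
  convert measurableSet_setOf_exists_mem_eq_zero hp
    (isSigmaCompact_unitInterval_inter_floor_fiber n k) using 1
  ext c
  simp only [Set.mem_ofPred_eq]
  exact exists_congr fun x => by tauto

/-! ### Kac's counting inequality for a fixed polynomial. -/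

/-- The integrand of Kac's counting formula at level `ε`. -/
noncomputable def kacIntegrand (p : ℝ[X]) (ε x : ℝ) : ℝ≥0∞ :=
  Set.indicator {y : ℝ | |p.eval y| < ε} (fun y => ‖p.derivative.eval y‖ₑ) x

theorem ofReal_le_lintegral_kacIntegrand {p : ℝ[X]} {ε a b : ℝ} (hab : a ≤ b)
    (hlt : ∀ x ∈ Set.Ioo a b, |p.eval x| < ε) (hε : ε ≤ |p.eval b - p.eval a|) :
    ENNReal.ofReal ε ≤ ∫⁻ x in Set.Ioo a b, kacIntegrand p ε x := by
  have hint : ∫ x in a..b, p.derivative.eval x = p.eval b - p.eval a :=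
    intervalIntegral.integral_eq_sub_of_hasDerivAt (fun x _ => p.hasDerivAt x)
      (p.derivative.continuous.intervalIntegrable a b)
  rw [intervalIntegral.integral_of_le hab, integral_Ioc_eq_integral_Ioo] at hint
  calc ENNReal.ofReal ε ≤ ENNReal.ofReal |p.eval b - p.eval a| := ENNReal.ofReal_le_ofReal hε
    _ = ‖∫ x in Set.Ioo a b, p.derivative.eval x‖ₑ := by rw [hint, Real.enorm_eq_ofReal_abs]
    _ ≤ ∫⁻ x in Set.Ioo a b, ‖p.derivative.eval x‖ₑ := enorm_integral_le_lintegral_enorm _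
    _ = ∫⁻ x in Set.Ioo a b, kacIntegrand p ε x := by
      refine setLIntegral_congr_fun measurableSet_Ioo fun x hx => ?_
      have hmem : x ∈ {y : ℝ | |p.eval y| < ε} := hlt x hx
      simp only [kacIntegrand, Set.indicator_of_mem hmem]

/-- Stop at the first point where `|p|` reaches `ε`: up to there `|p| < ε`, and `p` has changed by
at least `ε`. -/
theorem ofReal_le_lintegral_kacIntegrand_right {p : ℝ[X]} {ε a b : ℝ} (hab : a ≤ b)
    (ha : p.eval a = 0) (hb : ε ≤ |p.eval b|) :
    ENNReal.ofReal ε ≤ ∫⁻ x in Set.Ioo a b, kacIntegrand p ε x := by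
  have hK : IsCompact (Set.Icc a b ∩ {x | ε ≤ |p.eval x|}) :=
    isCompact_Icc.inter_right (isClosed_le continuous_const p.continuous.abs)
  obtain ⟨c, ⟨hc, hcε⟩, hmin⟩ := hK.exists_isLeast ⟨b, Set.right_mem_Icc.2 hab, hb⟩
  refine (ofReal_le_lintegral_kacIntegrand hc.1 (fun x hx => ?_) (by simpa [ha] using hcε)).trans
    (lintegral_mono_set (Set.Ioo_subset_Ioo_right hc.2))
  by_contra h
  exact (hmin ⟨⟨hx.1.le, hx.2.le.trans hc.2⟩, not_lt.1 h⟩).not_gt hx.2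

theorem ofReal_le_lintegral_kacIntegrand_left {p : ℝ[X]} {ε a b : ℝ} (hab : a ≤ b)
    (hb : p.eval b = 0) (ha : ε ≤ |p.eval a|) :
    ENNReal.ofReal ε ≤ ∫⁻ x in Set.Ioo a b, kacIntegrand p ε x := by
  have hK : IsCompact (Set.Icc a b ∩ {x | ε ≤ |p.eval x|}) :=
    isCompact_Icc.inter_right (isClosed_le continuous_const p.continuous.abs)
  obtain ⟨c, ⟨hc, hcε⟩, hmax⟩ := hK.exists_isGreatest ⟨a, Set.left_mem_Icc.2 hab, ha⟩
  refine (ofReal_le_lintegral_kacIntegrand hc.2 (fun x hx => ?_) (by simpa [hb] using hcε)).trans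
    (lintegral_mono_set (Set.Ioo_subset_Ioo_left hc.1))
  by_contra h
  exact (hmax ⟨⟨hc.1.trans hx.1.le, hx.2.le⟩, not_lt.1 h⟩).not_gt hx.1

theorem two_mul_ofReal_le_lintegral_kacIntegrand {p : ℝ[X]} {ε x r : ℝ} (hr : 0 ≤ r)
    (hx : p.eval x = 0) (hl : ε ≤ |p.eval (x - r)|) (hrt : ε ≤ |p.eval (x + r)|) :
    2 * ENNReal.ofReal ε ≤ ∫⁻ y in Set.Ioo (x - r) (x + r), kacIntegrand p ε y := by
  have hdisj : Disjoint (Set.Ioo (x - r) x) (Set.Ioo x (x + r)) :=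
    Set.disjoint_left.2 fun y h1 h2 => lt_asymm h1.2 h2.1
  rw [two_mul]
  refine (add_le_add
    (ofReal_le_lintegral_kacIntegrand_left (sub_le_self x hr) hx hl)
    (ofReal_le_lintegral_kacIntegrand_right (le_add_of_nonneg_right hr) hx hrt)).trans ?_
  rw [← lintegral_union measurableSet_Ioo hdisj]
  refine lintegral_mono_set (Set.union_subset (Set.Ioo_subset_Ioo_right (by linarith))
    (Set.Ioo_subset_Ioo_left (by linarith)))

open Filter Topology in
theorem exists_separating_radius {Z : Set ℝ} (hZ : Z.Finite) (hsub : Z ⊆ Set.Ioo 0 1) :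
    ∃ r > 0, (∀ x ∈ Z, 0 < x - r ∧ x + r < 1) ∧ ∀ x ∈ Z, ∀ y ∈ Z, x < y → x + r < y - r := by
  have h1 : ∀ x ∈ Z, ∀ᶠ r in 𝓝[>] (0 : ℝ), 0 < x - r ∧ x + r < 1 := by
    intro x hx
    filter_upwards [Ioo_mem_nhdsGT (hsub hx).1, Ioo_mem_nhdsGT (sub_pos.2 (hsub hx).2)] with r h h'
    exact ⟨by linarith [h.2], by linarith [h'.2]⟩
  have h2 : ∀ x ∈ Z, ∀ y ∈ Z, ∀ᶠ r in 𝓝[>] (0 : ℝ), x < y → x + r < y - r := by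
    intro x hx y hy
    by_cases hxy : x < y
    · filter_upwards [Ioo_mem_nhdsGT (half_pos (sub_pos.2 hxy))] with r h _
      linarith [h.2]
    · exact Eventually.of_forall fun r h => absurd h hxy
  have := ((eventually_all_finite hZ).2 h1).and
    ((eventually_all_finite hZ).2 fun x hx => (eventually_all_finite hZ).2 (h2 x hx))
  obtain ⟨r, hr, hr0⟩ := (this.and self_mem_nhdsWithin).exists
  exact ⟨r, hr0, hr⟩

-- Zeros need not be simple, since `|p|` rises on both sides even without a sign change. A zero at
-- an endpoint of `[0,1]` could contribute only `ε`, hence the two hypotheses.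
open Filter Topology in
theorem numZerosUnit_le_liminf {p : ℝ[X]} (h0 : p.eval 0 ≠ 0) (h1 : p.eval 1 ≠ 0) :
    numZerosUnit p ≤ liminf (fun n : ℕ => (2 * ENNReal.ofReal (1 / ((n : ℝ) + 1)))⁻¹ *
      ∫⁻ x in Set.Icc 0 1, kacIntegrand p (1 / ((n : ℝ) + 1)) x) atTop := by
  set Z : Set ℝ := {x | x ∈ Set.Icc (0 : ℝ) 1 ∧ p.eval x = 0} with hZdef
  have hp : p ≠ 0 := fun h => h0 (by simp [h])
  have hZfin : Z.Finite :=
    (p.rootSet_finite ℝ).subset fun x hx => by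
      simpa [Polynomial.mem_rootSet, hp] using hx.2
  have hZsub : Z ⊆ Set.Ioo 0 1 := fun x hx =>
    ⟨lt_of_le_of_ne hx.1.1 fun h => h0 (h ▸ hx.2), lt_of_le_of_ne hx.1.2 fun h => h1 (h ▸ hx.2)⟩
  obtain ⟨r, hr, hr01, hsep⟩ := exists_separating_radius hZfin hZsub
  -- A zero at `x ± r` would lie at distance `r` from `x`, whereas distinct zeros are more than `2r`
  -- apart.
  have hne : ∀ x ∈ Z, p.eval (x - r) ≠ 0 ∧ p.eval (x + r) ≠ 0 := by
    intro x hx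
    have hx' := hr01 x hx
    have hx01 := hZsub hx
    constructor
    · intro h
      have hm : x - r ∈ Z := ⟨⟨hx'.1.le, by linarith [hx01.2]⟩, h⟩
      linarith [hsep _ hm x hx (by linarith)]
    · intro h
      have hm : x + r ∈ Z := ⟨⟨by linarith [hx01.1], hx'.2.le⟩, h⟩
      linarith [hsep x hx _ hm (by linarith)]
  have hε : ∀ᶠ n : ℕ in atTop, ∀ x ∈ Z, 1 / ((n : ℝ) + 1) ≤ |p.eval (x - r)| ∧
      1 / ((n : ℝ) + 1) ≤ |p.eval (x + r)| :=
    (eventually_all_finite hZfin).2 fun x hx =>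
      (tendsto_one_div_add_atTop_nhds_zero_nat.eventually_le_const (abs_pos.2 (hne x hx).1)).and
      (tendsto_one_div_add_atTop_nhds_zero_nat.eventually_le_const (abs_pos.2 (hne x hx).2))
  refine le_liminf_of_le (by isBoundedDefault) ?_
  filter_upwards [hε] with n hn
  set ε : ℝ := 1 / ((n : ℝ) + 1)
  have hεpos : 0 < ε := by positivity
  have hcard : numZerosUnit p = (hZfin.toFinset.card : ℝ≥0∞) := by
    rw [numZerosUnit, ← hZdef, hZfin.encard_eq_coe_toFinset_card]
    simp
  have hkey : (hZfin.toFinset.card : ℝ≥0∞) * (2 * ENNReal.ofReal ε) ≤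
      ∫⁻ x in Set.Icc 0 1, kacIntegrand p ε x := by
    calc (hZfin.toFinset.card : ℝ≥0∞) * (2 * ENNReal.ofReal ε)
        = ∑ _x ∈ hZfin.toFinset, 2 * ENNReal.ofReal ε := by simp
      _ ≤ ∑ x ∈ hZfin.toFinset, ∫⁻ y in Set.Ioo (x - r) (x + r), kacIntegrand p ε y := by
          refine Finset.sum_le_sum fun x hx => ?_
          have hx' := hZfin.mem_toFinset.1 hx
          exact two_mul_ofReal_le_lintegral_kacIntegrand hr.le hx'.2 (hn x hx').1 (hn x hx').2
      _ = ∫⁻ y in ⋃ x ∈ hZfin.toFinset, Set.Ioo (x - r) (x + r), kacIntegrand p ε y := by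
          refine (lintegral_biUnion_finset (fun x hx y hy hxy => ?_)
            (fun _ _ => measurableSet_Ioo) _).symm
          have hx' := hZfin.mem_toFinset.1 hx
          have hy' := hZfin.mem_toFinset.1 hy
          refine Set.disjoint_left.2 fun z hz1 hz2 => ?_
          rcases lt_or_gt_of_ne hxy with h | h
          · linarith [hsep x hx' y hy' h, hz1.2, hz2.1]
          · linarith [hsep y hy' x hx' h, hz1.1, hz2.2]
      _ ≤ _ := by
          refine lintegral_mono_set (Set.iUnion₂_subset fun x hx y hy => ?_)
          have hx' := hr01 x (hZfin.mem_toFinset.1 hx)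
          exact ⟨by linarith [hy.1], by linarith [hy.2]⟩
  rw [hcard]
  have hne0 : 2 * ENNReal.ofReal ε ≠ 0 := by simp [hεpos]
  have hnetop : 2 * ENNReal.ofReal ε ≠ ∞ := ENNReal.mul_ne_top (by simp) ENNReal.ofReal_ne_top
  rw [mul_comm, ← div_eq_mul_inv]
  exact (ENNReal.le_div_iff_mul_le (Or.inl hne0) (Or.inl hnetop)).2 hkey

/-! ### Integrating out one coordinate of a product measure. -/

section CoordinateIntegration

variable {ι : Type*} [Fintype ι] {μ : ι → Measure ℝ} [∀ q, IsProbabilityMeasure (μ q)]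

theorem lintegral_eval_pi (p : ι) {g : ℝ → ℝ≥0∞} (hg : Measurable g) :
    ∫⁻ c, g (c p) ∂Measure.pi μ = ∫⁻ y, g y ∂μ p :=
  (measurePreserving_eval μ p).lintegral_comp hg

variable [DecidableEq ι]

theorem lintegral_pi_mono_of_update (p : ι) {f g : (ι → ℝ) → ℝ≥0∞} (hf : Measurable f)
    (hg : Measurable g) (h : ∀ c, ∫⁻ y, f (Function.update c p y) ∂μ p ≤
      ∫⁻ y, g (Function.update c p y) ∂μ p) :
    ∫⁻ c, f c ∂Measure.pi μ ≤ ∫⁻ c, g c ∂Measure.pi μ := by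
  refine lintegral_le_of_lmarginal_le {p} hf hg ?_
  rw [lmarginal_singleton, lmarginal_singleton]
  exact h

/-- With the other coordinates frozen and slope `G c ≠ 0`, only one value of coordinate `p` makes
`H` vanish, and it has measure zero. -/
theorem ae_ne_zero_of_affine (p : ι) [NullSingletonClass (μ p)] {G H : (ι → ℝ) → ℝ} (hG : Measurable G)
    (hH : Measurable H) (hGp : ∀ c y, G (Function.update c p y) = G c)
    (hHp : ∀ c y, H (Function.update c p y) = y * G c + H (Function.update c p 0)) :
    ∀ᵐ c ∂Measure.pi μ, G c ≠ 0 → H c ≠ 0 := by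
  have hmeas : MeasurableSet {c | G c ≠ 0 ∧ H c = 0} :=
    (measurableSet_eq_fun hG measurable_const).compl.inter
      (measurableSet_eq_fun hH measurable_const)
  have hnull : Measure.pi μ {c | G c ≠ 0 ∧ H c = 0} = 0 := by
    rw [← nonpos_iff_eq_zero, ← lintegral_indicator_one hmeas]
    refine (lintegral_pi_mono_of_update (g := fun _ => 0) p
      (measurable_const.indicator hmeas) measurable_const fun c => ?_).trans (by simp)
    rw [lintegral_zero, nonpos_iff_eq_zero]
    have hsub : {y | G c ≠ 0 ∧ H (Function.update c p y) = 0} ⊆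
        {-H (Function.update c p 0) / G c} := by
      rintro y ⟨h1, h2⟩
      rw [hHp] at h2
      rw [Set.mem_singleton_iff, eq_div_iff h1]
      linarith
    refine lintegral_eq_zero_of_ae_eq_zero ?_
    have : ∀ᵐ y ∂μ p, y ∉ ({-H (Function.update c p 0) / G c} : Set ℝ) :=
      measure_eq_zero_iff_ae_notMem.1 (measure_singleton _)
    filter_upwards [this] with y hy
    refine Set.indicator_of_notMem (fun h => hy (hsub ?_)) _
    have h' : G (Function.update c p y) ≠ 0 ∧ H (Function.update c p y) = 0 := h
    exact ⟨hGp c y ▸ h'.1, h'.2⟩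
  filter_upwards [measure_eq_zero_iff_ae_notMem.1 hnull] with c hc h1 h2
  exact hc ⟨h1, h2⟩

/-- For `g ≠ 0` the set is an interval of length `2ε / |g|`; the factor `‖g‖ₑ` makes the bound
independent of the slope. -/
theorem measure_abs_affine_lt_mul_enorm_le {ρ : Measure ℝ} {A : ℝ≥0∞} (hρ : ρ ≤ A • volume)
    (g r : ℝ) (ε : ℝ) :
    ρ {y | |y * g + r| < ε} * ‖g‖ₑ ≤ 2 * ENNReal.ofReal ε * A := by
  by_cases hg : g = 0
  · simp [hg]
  have hg' : 0 < |g| := abs_pos.2 hg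
  have hset : {y | |y * g + r| < ε} = Metric.ball (-r / g) (ε / |g|) := by
    ext y
    have : y * g + r = (y - -r / g) * g := by field_simp; ring
    rw [Set.mem_ofPred_eq, Metric.mem_ball, Real.dist_eq, lt_div_iff₀ hg', ← abs_mul, this]
  rw [hset]
  calc ρ (Metric.ball (-r / g) (ε / |g|)) * ‖g‖ₑ
      ≤ A * volume (Metric.ball (-r / g) (ε / |g|)) * ‖g‖ₑ := by
        gcongr
        exact hρ _
    _ = A * (volume (Metric.ball (-r / g) (ε / |g|)) * ‖g‖ₑ) := mul_assoc _ _ _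
    _ = A * (2 * ENNReal.ofReal ε) := by
        rw [Real.volume_ball, Real.enorm_eq_ofReal_abs, ← ENNReal.ofReal_mul' (abs_nonneg g),
          mul_assoc, div_mul_cancel₀ _ hg'.ne', ENNReal.ofReal_mul zero_le_two,
          ENNReal.ofReal_ofNat]
    _ = 2 * ENNReal.ofReal ε * A := mul_comm _ _

theorem lintegral_indicator_abs_affine_lt_le (p : ι) {A : ℝ≥0∞} (hA : μ p ≤ A • volume)
    {G H : (ι → ℝ) → ℝ} {W : (ι → ℝ) → ℝ≥0∞} (hG : Measurable G) (hH : Measurable H)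
    (hW : Measurable W) (hGp : ∀ c y, G (Function.update c p y) = G c)
    (hHp : ∀ c y, H (Function.update c p y) = y * G c + H (Function.update c p 0))
    (hWp : ∀ c y, W (Function.update c p y) = W c) (ε : ℝ) :
    ∫⁻ c, Set.indicator {c | |H c| < ε} (fun c => ‖G c‖ₑ * W c) c ∂Measure.pi μ ≤
      2 * ENNReal.ofReal ε * A * ∫⁻ c, W c ∂Measure.pi μ := by
  have hmeas : MeasurableSet {c | |H c| < ε} := measurableSet_lt hH.abs measurable_const
  rw [← lintegral_const_mul _ hW]
  refine lintegral_pi_mono_of_update p ((hG.enorm.mul hW).indicator hmeas) (hW.const_mul _)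
    fun c => ?_
  simp_rw [hWp, lintegral_const, measure_univ, mul_one]
  have hEq : ∀ y, Set.indicator {c | |H c| < ε} (fun c => ‖G c‖ₑ * W c) (Function.update c p y) =
      Set.indicator {y | |y * G c + H (Function.update c p 0)| < ε} (fun _ => ‖G c‖ₑ * W c) y := by
    intro y
    simp only [Set.indicator_apply, Set.mem_ofPred_eq, hHp c y, hGp, hWp]
  have hmeas' : MeasurableSet {y | |y * G c + H (Function.update c p 0)| < ε} :=
    measurableSet_lt (by fun_prop) measurable_const
  simp_rw [hEq]
  rw [lintegral_indicator_const hmeas', mul_comm, ← mul_assoc]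
  exact mul_le_mul_left (measure_abs_affine_lt_mul_enorm_le hA _ _ _) _

end CoordinateIntegration

/-! ### Measures with convenient densities. -/

section ConvenientDensity

variable {φ : ℝ → ℝ}

theorem IsConvenientDensity.isProbabilityMeasure (hφ : IsConvenientDensity φ) :
    IsProbabilityMeasure (volume.withDensity fun v => ENNReal.ofReal (φ v)) :=
  ⟨by rw [withDensity_apply _ MeasurableSet.univ, setLIntegral_univ, hφ.lintegral_eq_one]⟩

theorem withDensity_ofReal_le_smul {A : ℝ} (hA : ∀ᵐ v : ℝ, φ v ≤ A) :
    volume.withDensity (fun v => ENNReal.ofReal (φ v)) ≤ ENNReal.ofReal A • volume := by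
  rw [← withDensity_const]
  exact withDensity_mono (hA.mono fun v hv => ENNReal.ofReal_le_ofReal hv)

theorem IsConvenientDensity.lintegral_enorm (hφ : IsConvenientDensity φ) :
    ∫⁻ y, ‖y‖ₑ ∂(volume.withDensity fun v => ENNReal.ofReal (φ v)) =
      ENNReal.ofReal (absMoment φ) := by
  rw [lintegral_withDensity_eq_lintegral_mul _ hφ.measurable.ennreal_ofReal measurable_enorm,
    absMoment, ofReal_integral_eq_lintegral_ofReal hφ.integrable_abs_mul
      (Filter.Eventually.of_forall fun u => mul_nonneg (abs_nonneg u) (hφ.nonneg u))]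
  refine lintegral_congr fun y => ?_
  rw [Pi.mul_apply, Real.enorm_eq_ofReal_abs, mul_comm, ENNReal.ofReal_mul (abs_nonneg y)]

end ConvenientDensity

/-! ### Dependence of the polynomials on a constant coefficient. -/

section SparsePolynomials

variable {m : ℕ} {k : Fin m → ℕ} (S : (i : Fin m) → Fin (k i) → Finset ℕ)

theorem eval_sparsePoly (c : CoeffIndex S → ℝ) (i : Fin m) (j : Fin (k i)) (x : ℝ) :
    (sparsePoly S c i j).eval x = ∑ s : {s : ℕ // s ∈ S i j}, c ⟨i, j, s⟩ * x ^ (s : ℕ) := by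
  simp [sparsePoly, Polynomial.eval_finsetSum]

theorem eval_derivative_sparsePoly (c : CoeffIndex S → ℝ) (i : Fin m) (j : Fin (k i)) (x : ℝ) :
    (sparsePoly S c i j).derivative.eval x =
      ∑ s : {s : ℕ // s ∈ S i j}, c ⟨i, j, s⟩ * ((s : ℕ) * x ^ ((s : ℕ) - 1)) := by
  simp [sparsePoly, Polynomial.derivative_X_pow, Polynomial.eval_finsetSum]

/-- The product of all factors of the `i`-th summand other than the `j`-th one. -/
noncomputable def cofactor (c : CoeffIndex S → ℝ) (i : Fin m) (j : Fin (k i)) : ℝ[X] :=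
  ∏ l ∈ Finset.univ.erase j, sparsePoly S c i l

theorem derivative_sumProdSparse (c : CoeffIndex S → ℝ) :
    (sumProdSparse S c).derivative =
      ∑ i, ∑ j, cofactor S c i j * (sparsePoly S c i j).derivative := by
  simp only [sumProdSparse, Polynomial.derivative_sum, Polynomial.derivative_prod_finset, cofactor]

theorem eval_cofactor (c : CoeffIndex S → ℝ) (i : Fin m) (j : Fin (k i)) (x : ℝ) :
    (cofactor S c i j).eval x = ∏ l ∈ Finset.univ.erase j, (sparsePoly S c i l).eval x :=
  Polynomial.eval_prod _ _ _

theorem continuous_eval_sparsePoly (i : Fin m) (j : Fin (k i)) :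
    Continuous fun z : (CoeffIndex S → ℝ) × ℝ => (sparsePoly S z.1 i j).eval z.2 := by
  simp only [eval_sparsePoly]
  fun_prop

theorem continuous_eval_derivative_sparsePoly (i : Fin m) (j : Fin (k i)) :
    Continuous fun z : (CoeffIndex S → ℝ) × ℝ => (sparsePoly S z.1 i j).derivative.eval z.2 := by
  simp only [eval_derivative_sparsePoly]
  fun_prop

theorem continuous_eval_cofactor (i : Fin m) (j : Fin (k i)) :
    Continuous fun z : (CoeffIndex S → ℝ) × ℝ => (cofactor S z.1 i j).eval z.2 := by
  simp only [eval_cofactor]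
  exact continuous_finsetProd _ fun l _ => continuous_eval_sparsePoly S i l

theorem continuous_eval_sumProdSparse :
    Continuous fun z : (CoeffIndex S → ℝ) × ℝ => (sumProdSparse S z.1).eval z.2 := by
  simp only [sumProdSparse, Polynomial.eval_finsetSum, Polynomial.eval_prod]
  exact continuous_finsetSum _ fun i _ => continuous_finsetProd _ fun j _ =>
    continuous_eval_sparsePoly S i j

theorem continuous_eval_derivative_sumProdSparse :
    Continuous fun z : (CoeffIndex S → ℝ) × ℝ => (sumProdSparse S z.1).derivative.eval z.2 := by
  simp only [derivative_sumProdSparse, Polynomial.eval_finsetSum, Polynomial.eval_mul]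
  exact continuous_finsetSum _ fun i _ => continuous_finsetSum _ fun j _ =>
    (continuous_eval_cofactor S i j).mul (continuous_eval_derivative_sparsePoly S i j)

variable {S}

theorem sparsePoly_update_of_ne {i : Fin m} {j : Fin (k i)} {s : {s : ℕ // s ∈ S i j}}
    {i' : Fin m} {j' : Fin (k i')} (h : (⟨i', j'⟩ : Σ i, Fin (k i)) ≠ ⟨i, j⟩)
    (c : CoeffIndex S → ℝ) (y : ℝ) :
    sparsePoly S (Function.update c ⟨i, j, s⟩ y) i' j' = sparsePoly S c i' j' := by
  refine Finset.sum_congr rfl fun s' _ => ?_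
  rw [Function.update_of_ne]
  intro h'
  refine h ?_
  exact congrArg (fun q : CoeffIndex S => (⟨q.1, q.2.1⟩ : Σ i, Fin (k i))) h'

theorem cofactor_update {i : Fin m} {j : Fin (k i)} {s : {s : ℕ // s ∈ S i j}}
    (c : CoeffIndex S → ℝ) (y : ℝ) :
    cofactor S (Function.update c ⟨i, j, s⟩ y) i j = cofactor S c i j := by
  refine Finset.prod_congr rfl fun l hl => sparsePoly_update_of_ne ?_ c y
  simpa using Finset.ne_of_mem_erase hl

theorem sparsePoly_update_zero {i : Fin m} {j : Fin (k i)} (h : 0 ∈ S i j)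
    (c : CoeffIndex S → ℝ) (y : ℝ) :
    sparsePoly S (Function.update c ⟨i, j, ⟨0, h⟩⟩ y) i j =
      Polynomial.C y + sparsePoly S (Function.update c ⟨i, j, ⟨0, h⟩⟩ 0) i j := by
  have key : ∀ z, sparsePoly S (Function.update c ⟨i, j, ⟨0, h⟩⟩ z) i j = Polynomial.C z +
      ∑ s ∈ Finset.univ.erase (⟨0, h⟩ : {s : ℕ // s ∈ S i j}),
        Polynomial.C (c ⟨i, j, s⟩) * Polynomial.X ^ (s : ℕ) := by
    intro z
    rw [sparsePoly, ← Finset.add_sum_erase _ _ (Finset.mem_univ (⟨0, h⟩ : {s : ℕ // s ∈ S i j}))]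
    congr 1
    · simp
    · refine Finset.sum_congr rfl fun s hs => ?_
      rw [Function.update_of_ne]
      simpa using Finset.ne_of_mem_erase hs
  rw [key y, key 0]
  simp

theorem derivative_sparsePoly_update_zero {i : Fin m} {j : Fin (k i)} (h : 0 ∈ S i j)
    (c : CoeffIndex S → ℝ) (y : ℝ) :
    (sparsePoly S (Function.update c ⟨i, j, ⟨0, h⟩⟩ y) i j).derivative =
      (sparsePoly S c i j).derivative := by
  have h1 := sparsePoly_update_zero h c y
  have h2 := sparsePoly_update_zero h c (c ⟨i, j, ⟨0, h⟩⟩)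
  rw [Function.update_eq_self] at h2
  simp [h1, h2]

/-- Only the factor `(i, j)` contains the changed coefficient, so the sum is affine in it with slope
the cofactor. -/
theorem sumProdSparse_update_zero {i : Fin m} {j : Fin (k i)} (h : 0 ∈ S i j)
    (c : CoeffIndex S → ℝ) (y : ℝ) :
    sumProdSparse S (Function.update c ⟨i, j, ⟨0, h⟩⟩ y) =
      Polynomial.C y * cofactor S c i j +
        sumProdSparse S (Function.update c ⟨i, j, ⟨0, h⟩⟩ 0) := by
  have key : ∀ z, sumProdSparse S (Function.update c ⟨i, j, ⟨0, h⟩⟩ z) =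
      sparsePoly S (Function.update c ⟨i, j, ⟨0, h⟩⟩ z) i j * cofactor S c i j +
        ∑ i' ∈ Finset.univ.erase i, ∏ j', sparsePoly S c i' j' := by
    intro z
    rw [sumProdSparse, ← Finset.add_sum_erase _ _ (Finset.mem_univ i)]
    congr 1
    · rw [← Finset.mul_prod_erase _ _ (Finset.mem_univ j)]
      exact congrArg _ (cofactor_update c z)
    · refine Finset.sum_congr rfl fun i' hi' => Finset.prod_congr rfl fun j' _ => ?_
      refine sparsePoly_update_of_ne (fun h' => ?_) c z
      exact Finset.ne_of_mem_erase hi' (congrArg Sigma.fst h')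
  rw [key y, key 0, sparsePoly_update_zero h c y]
  ring

end SparsePolynomials

/-- This is the total variation of `x ^ s` on `[0,1]`. Its vanishing at `s = 0` turns `t` into `t -
1`. -/
theorem lintegral_enorm_natCast_mul_pow_le (s : ℕ) :
    ∫⁻ x in Set.Icc (0 : ℝ) 1, ‖(s : ℝ) * x ^ (s - 1)‖ₑ ≤ if s = 0 then 0 else 1 := by
  split_ifs with hs
  · simp [hs]
  have hint : ∫ x in (0 : ℝ)..1, (s : ℝ) * x ^ (s - 1) = 1 := by
    rw [intervalIntegral.integral_eq_sub_of_hasDerivAt (fun x _ => hasDerivAt_pow s x)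
      (Continuous.intervalIntegrable (by fun_prop) _ _)]
    simp [hs]
  rw [intervalIntegral.integral_of_le zero_le_one, ← integral_Icc_eq_integral_Ioc] at hint
  have hcont : Continuous fun x : ℝ => (s : ℝ) * x ^ (s - 1) := by fun_prop
  have hpos : ∀ᵐ x ∂volume.restrict (Set.Icc (0 : ℝ) 1), 0 ≤ (s : ℝ) * x ^ (s - 1) := by
    filter_upwards [ae_restrict_mem measurableSet_Icc] with x hx
    exact mul_nonneg s.cast_nonneg (pow_nonneg hx.1 _)
  have hlin := ofReal_integral_eq_lintegral_ofReal hcont.integrableOn_Icc hpos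
  rw [hint, ENNReal.ofReal_one] at hlin
  rw [hlin]
  exact lintegral_mono_ae (hpos.mono fun x hx => (Real.enorm_of_nonneg hx).le)

/-! ### Expectation bounds for random coefficients. -/

section Expectation

variable {m : ℕ} {k : Fin m → ℕ} {S : (i : Fin m) → Fin (k i) → Finset ℕ}
  {μ : CoeffIndex S → Measure ℝ} [∀ p, IsProbabilityMeasure (μ p)]

theorem ae_eval_sparsePoly_ne_zero [∀ p, NullSingletonClass (μ p)] (hS0 : ∀ i j, 0 ∈ S i j) (i : Fin m)
    (j : Fin (k i)) (x : ℝ) :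
    ∀ᵐ c ∂Measure.pi μ, (sparsePoly S c i j).eval x ≠ 0 := by
  have hmeas : Measurable fun c => (sparsePoly S c i j).eval x :=
    ((continuous_eval_sparsePoly S i j).comp (by fun_prop : Continuous fun c => (c, x))).measurable
  have := ae_ne_zero_of_affine (μ := μ) ⟨i, j, ⟨0, hS0 i j⟩⟩ (G := fun _ => 1) measurable_const
    hmeas (fun _ _ => rfl) fun c y => by
      rw [sparsePoly_update_zero (hS0 i j)]
      simp
  simpa using this

/-- Used at `x = 0` and `x = 1` to meet the hypotheses of `numZerosUnit_le_liminf`. The slope in the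
constant coefficient is a product of factors that are almost surely nonzero. -/
theorem ae_eval_sumProdSparse_ne_zero [∀ p, NullSingletonClass (μ p)] (hS0 : ∀ i j, 0 ∈ S i j) (i : Fin m)
    (j : Fin (k i)) (x : ℝ) :
    ∀ᵐ c ∂Measure.pi μ, (sumProdSparse S c).eval x ≠ 0 := by
  have hpair : Continuous fun c : CoeffIndex S → ℝ => (c, x) := by fun_prop
  have h1 := ae_ne_zero_of_affine (μ := μ) ⟨i, j, ⟨0, hS0 i j⟩⟩
    ((continuous_eval_cofactor S i j).comp hpair).measurable
    ((continuous_eval_sumProdSparse S).comp hpair).measurable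
    (fun c y => by simp [cofactor_update]) fun c y => by
      simp only [Function.comp_apply]
      rw [sumProdSparse_update_zero (hS0 i j)]
      simp
  have h2 : ∀ᵐ c ∂Measure.pi μ, ∀ l, (sparsePoly S c i l).eval x ≠ 0 :=
    ae_all_iff.2 fun l => ae_eval_sparsePoly_ne_zero hS0 i l x
  filter_upwards [h1, h2] with c hc1 hc2
  refine hc1 ?_
  simp only [Function.comp_apply, eval_cofactor]
  exact Finset.prod_ne_zero_iff.2 fun l _ => hc2 l

theorem lintegral_enorm_eval_derivative_sparsePoly_le {B : ℝ≥0∞}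
    (hB : ∀ p, ∫⁻ y, ‖y‖ₑ ∂μ p ≤ B) (i : Fin m) (j : Fin (k i)) (x : ℝ) :
    ∫⁻ c, ‖(sparsePoly S c i j).derivative.eval x‖ₑ ∂Measure.pi μ ≤
      ∑ s : {s : ℕ // s ∈ S i j}, B * ‖((s : ℕ) : ℝ) * x ^ ((s : ℕ) - 1)‖ₑ := by
  have hmeas : ∀ p : CoeffIndex S, Measurable fun c : CoeffIndex S → ℝ => ‖c p‖ₑ :=
    fun p => (measurable_pi_apply p).enorm
  calc ∫⁻ c, ‖(sparsePoly S c i j).derivative.eval x‖ₑ ∂Measure.pi μ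
      ≤ ∫⁻ c, ∑ s : {s : ℕ // s ∈ S i j},
          ‖c ⟨i, j, s⟩‖ₑ * ‖((s : ℕ) : ℝ) * x ^ ((s : ℕ) - 1)‖ₑ ∂Measure.pi μ := by
        refine lintegral_mono fun c => ?_
        rw [eval_derivative_sparsePoly]
        refine (enorm_sum_le _ _).trans_eq (Finset.sum_congr rfl fun s _ => enorm_mul _ _)
    _ = ∑ s : {s : ℕ // s ∈ S i j},
          (∫⁻ y, ‖y‖ₑ ∂μ ⟨i, j, s⟩) * ‖((s : ℕ) : ℝ) * x ^ ((s : ℕ) - 1)‖ₑ := by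
        rw [lintegral_finsetSum _ fun s _ => (hmeas _).mul_const _]
        refine Finset.sum_congr rfl fun s _ => ?_
        rw [lintegral_mul_const _ (hmeas _), lintegral_eval_pi _ measurable_enorm]
    _ ≤ _ := by
        gcongr
        exact hB _

theorem lintegral_sum_enorm_natCast_mul_pow_le {T : Finset ℕ} (h0 : 0 ∈ T) {t : ℕ}
    (ht : T.card ≤ t) (B : ℝ≥0∞) :
    ∫⁻ x in Set.Icc (0 : ℝ) 1, ∑ s : {s : ℕ // s ∈ T},
      B * ‖((s : ℕ) : ℝ) * x ^ ((s : ℕ) - 1)‖ₑ ≤ B * ((t - 1 : ℕ) : ℝ≥0∞) := by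
  have hmeas : ∀ s : ℕ, Measurable fun x : ℝ => ‖(s : ℝ) * x ^ (s - 1)‖ₑ := fun s => by fun_prop
  rw [lintegral_finsetSum _ fun (s : {s : ℕ // s ∈ T}) _ => (hmeas s).const_mul B]
  calc ∑ s : {s : ℕ // s ∈ T},
        ∫⁻ x in Set.Icc (0 : ℝ) 1, B * ‖((s : ℕ) : ℝ) * x ^ ((s : ℕ) - 1)‖ₑ
      ≤ ∑ s : {s : ℕ // s ∈ T}, B * (if (s : ℕ) = 0 then 0 else 1) := by
        refine Finset.sum_le_sum fun s _ => ?_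
        rw [lintegral_const_mul _ (hmeas s)]
        gcongr
        exact lintegral_enorm_natCast_mul_pow_le s
    _ = B * ∑ s ∈ T, (if s = 0 then 0 else 1) := by
        rw [← Finset.mul_sum, ← Finset.sum_coe_sort T]
    _ = B * ((T.card - 1 : ℕ) : ℝ≥0∞) := by
        rw [← Finset.add_sum_erase _ _ h0, if_pos rfl, zero_add,
          Finset.sum_congr rfl fun s hs => if_neg (Finset.ne_of_mem_erase hs)]
        simp [Finset.card_erase_of_mem h0]
    _ ≤ B * ((t - 1 : ℕ) : ℝ≥0∞) := by gcongr

theorem measurable_kacIntegrand_sumProdSparse (ε : ℝ) :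
    Measurable fun z : (CoeffIndex S → ℝ) × ℝ => kacIntegrand (sumProdSparse S z.1) ε z.2 := by
  have hset : MeasurableSet
      {z : (CoeffIndex S → ℝ) × ℝ | |(sumProdSparse S z.1).eval z.2| < ε} :=
    measurableSet_lt (continuous_eval_sumProdSparse S).abs.measurable measurable_const
  exact (continuous_eval_derivative_sumProdSparse S).enorm.measurable.indicator hset

/-- After the triangle inequality each summand of the product rule is integrated over a different
coordinate, the constant coefficient of the factor being differentiated. -/
theorem lintegral_kacIntegrand_sumProdSparse_le {A B : ℝ≥0∞} (hS0 : ∀ i j, 0 ∈ S i j)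
    (hA : ∀ p, μ p ≤ A • volume) (hB : ∀ p, ∫⁻ y, ‖y‖ₑ ∂μ p ≤ B) (ε x : ℝ) :
    ∫⁻ c, kacIntegrand (sumProdSparse S c) ε x ∂Measure.pi μ ≤
      ∑ i, ∑ j, 2 * ENNReal.ofReal ε * A *
        ∑ s : {s : ℕ // s ∈ S i j}, B * ‖((s : ℕ) : ℝ) * x ^ ((s : ℕ) - 1)‖ₑ := by
  have hpair : Continuous fun c : CoeffIndex S → ℝ => (c, x) := by fun_prop
  have hF : Measurable fun c => (sumProdSparse S c).eval x :=
    ((continuous_eval_sumProdSparse S).comp hpair).measurable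
  have hG : ∀ i j, Measurable fun c => (cofactor S c i j).eval x := fun i j =>
    ((continuous_eval_cofactor S i j).comp hpair).measurable
  have hW : ∀ i j, Measurable fun c => ‖(sparsePoly S c i j).derivative.eval x‖ₑ := fun i j =>
    ((continuous_eval_derivative_sparsePoly S i j).comp hpair).enorm.measurable
  let V (i : Fin m) (j : Fin (k i)) (c : CoeffIndex S → ℝ) : ℝ≥0∞ :=
    Set.indicator {c | |(sumProdSparse S c).eval x| < ε}
      (fun c => ‖(cofactor S c i j).eval x‖ₑ * ‖(sparsePoly S c i j).derivative.eval x‖ₑ) c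
  have hV : ∀ i j, Measurable (V i j) := fun i j =>
    ((hG i j).enorm.mul (hW i j)).indicator (measurableSet_lt hF.abs measurable_const)
  calc ∫⁻ c, kacIntegrand (sumProdSparse S c) ε x ∂Measure.pi μ
      ≤ ∫⁻ c, ∑ i, ∑ j, V i j c ∂Measure.pi μ := by
        refine lintegral_mono fun c => ?_
        simp only [kacIntegrand, V, Set.indicator_apply, Set.mem_ofPred_eq]
        split_ifs
        · rw [derivative_sumProdSparse]
          simp only [Polynomial.eval_finsetSum, Polynomial.eval_mul]
          refine (enorm_sum_le _ _).trans (Finset.sum_le_sum fun i _ => ?_)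
          exact (enorm_sum_le _ _).trans_eq (Finset.sum_congr rfl fun j _ => enorm_mul _ _)
        · exact zero_le
    _ = ∑ i, ∑ j, ∫⁻ c, V i j c ∂Measure.pi μ := by
        rw [lintegral_finsetSum _ fun i _ => Finset.measurable_fun_sum _ fun j _ => hV i j]
        exact Finset.sum_congr rfl fun i _ => lintegral_finsetSum _ fun j _ => hV i j
    _ ≤ _ := by
        refine Finset.sum_le_sum fun i _ => Finset.sum_le_sum fun j _ => ?_
        refine (lintegral_indicator_abs_affine_lt_le ⟨i, j, ⟨0, hS0 i j⟩⟩ (hA _) (hG i j) hF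
          (hW i j) (fun c y => by rw [cofactor_update]) (fun c y => ?_)
          (fun c y => by rw [derivative_sparsePoly_update_zero]) ε).trans ?_
        · rw [sumProdSparse_update_zero (hS0 i j)]
          simp
        · gcongr
          exact lintegral_enorm_eval_derivative_sparsePoly_le hB i j x

theorem lintegral_lintegral_kacIntegrand_le {A B : ℝ≥0∞} {t : ℕ} (hS0 : ∀ i j, 0 ∈ S i j)
    (hSt : ∀ i j, (S i j).card ≤ t) (hA : ∀ p, μ p ≤ A • volume)
    (hB : ∀ p, ∫⁻ y, ‖y‖ₑ ∂μ p ≤ B) (ε : ℝ) :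
    ∫⁻ c, (∫⁻ x in Set.Icc (0 : ℝ) 1, kacIntegrand (sumProdSparse S c) ε x) ∂Measure.pi μ ≤
      2 * ENNReal.ofReal ε * (A * B * (∑ i, (k i : ℝ≥0∞)) * ((t - 1 : ℕ) : ℝ≥0∞)) := by
  have hmeas : ∀ i j, Measurable fun x : ℝ => ∑ s : {s : ℕ // s ∈ S i j},
      B * ‖((s : ℕ) : ℝ) * x ^ ((s : ℕ) - 1)‖ₑ := fun i j =>
    Finset.measurable_fun_sum _ fun s _ => Measurable.const_mul (by fun_prop) _
  -- Tonelli: the coefficient estimate is available at each fixed `x`.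
  rw [lintegral_lintegral_swap (measurable_kacIntegrand_sumProdSparse ε).aemeasurable]
  calc _ ≤ ∫⁻ x in Set.Icc (0 : ℝ) 1, ∑ i, ∑ j, 2 * ENNReal.ofReal ε * A *
        ∑ s : {s : ℕ // s ∈ S i j}, B * ‖((s : ℕ) : ℝ) * x ^ ((s : ℕ) - 1)‖ₑ :=
        lintegral_mono fun x => lintegral_kacIntegrand_sumProdSparse_le hS0 hA hB ε x
    _ = ∑ i, ∑ j, 2 * ENNReal.ofReal ε * A * ∫⁻ x in Set.Icc (0 : ℝ) 1,
        ∑ s : {s : ℕ // s ∈ S i j}, B * ‖((s : ℕ) : ℝ) * x ^ ((s : ℕ) - 1)‖ₑ := by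
        rw [lintegral_finsetSum _ fun i _ =>
          Finset.measurable_fun_sum _ fun j _ => (hmeas i j).const_mul _]
        refine Finset.sum_congr rfl fun i _ => ?_
        rw [lintegral_finsetSum _ fun j _ => (hmeas i j).const_mul _]
        exact Finset.sum_congr rfl fun j _ => lintegral_const_mul _ (hmeas i j)
    _ ≤ ∑ i, ∑ _j : Fin (k i), 2 * ENNReal.ofReal ε * A * (B * ((t - 1 : ℕ) : ℝ≥0∞)) := by
        gcongr with i _ j _
        exact lintegral_sum_enorm_natCast_mul_pow_le (hS0 i j) (hSt i j) B
    _ = _ := by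
        simp only [Finset.sum_const, Finset.card_univ, Fintype.card_fin, nsmul_eq_mul]
        rw [← Finset.sum_mul]
        ring

-- Fatou's lemma; the normalisation `(2ε)⁻¹` cancels the `2ε` of the previous bound, leaving an
-- estimate uniform in `n`.
open Filter in
theorem lintegral_numZerosUnit_sumProdSparse_le [∀ p, NullSingletonClass (μ p)] {A B : ℝ≥0∞} {t : ℕ}
    (hS0 : ∀ i j, 0 ∈ S i j) (hSt : ∀ i j, (S i j).card ≤ t) (i : Fin m) (j : Fin (k i))
    (hA : ∀ p, μ p ≤ A • volume) (hB : ∀ p, ∫⁻ y, ‖y‖ₑ ∂μ p ≤ B) :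
    ∫⁻ c, numZerosUnit (sumProdSparse S c) ∂Measure.pi μ ≤
      A * B * (∑ i, (k i : ℝ≥0∞)) * ((t - 1 : ℕ) : ℝ≥0∞) := by
  have hmeas : ∀ ε : ℝ, Measurable fun c : CoeffIndex S → ℝ =>
      ∫⁻ x in Set.Icc (0 : ℝ) 1, kacIntegrand (sumProdSparse S c) ε x := fun ε =>
    (measurable_kacIntegrand_sumProdSparse ε).lintegral_prod_right'
  calc ∫⁻ c, numZerosUnit (sumProdSparse S c) ∂Measure.pi μ
      ≤ ∫⁻ c, liminf (fun n : ℕ => (2 * ENNReal.ofReal (1 / ((n : ℝ) + 1)))⁻¹ *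
          ∫⁻ x in Set.Icc 0 1, kacIntegrand (sumProdSparse S c) (1 / ((n : ℝ) + 1)) x) atTop
            ∂Measure.pi μ := by
        refine lintegral_mono_ae ?_
        filter_upwards [ae_eval_sumProdSparse_ne_zero hS0 i j 0,
          ae_eval_sumProdSparse_ne_zero hS0 i j 1] with c h0 h1
        exact numZerosUnit_le_liminf h0 h1
    _ ≤ liminf (fun n : ℕ => ∫⁻ c, (2 * ENNReal.ofReal (1 / ((n : ℝ) + 1)))⁻¹ *
          (∫⁻ x in Set.Icc 0 1, kacIntegrand (sumProdSparse S c) (1 / ((n : ℝ) + 1)) x)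
            ∂Measure.pi μ) atTop :=
        lintegral_liminf_le fun n => (hmeas _).const_mul _
    _ ≤ _ := by
        refine liminf_le_of_frequently_le' (Frequently.of_forall fun n => ?_)
        have hpos : (0 : ℝ) < 1 / ((n : ℝ) + 1) := by positivity
        have hne0 : 2 * ENNReal.ofReal (1 / ((n : ℝ) + 1)) ≠ 0 :=
          mul_ne_zero two_ne_zero (ENNReal.ofReal_pos.2 hpos).ne'
        have hnetop : 2 * ENNReal.ofReal (1 / ((n : ℝ) + 1)) ≠ ∞ :=
          ENNReal.mul_ne_top ENNReal.ofNat_ne_top ENNReal.ofReal_ne_top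
        rw [lintegral_const_mul _ (hmeas _), ENNReal.inv_mul_le_iff hne0 hnetop]
        exact lintegral_lintegral_kacIntegrand_le hS0 hSt hA hB _

end Expectation

/-- No sign condition is needed, because the left side is zero for `a ≤ 0`; thus `A` and `B` need
not be shown nonnegative. -/
theorem ofReal_mul_ofReal_le (a b : ℝ) :
    ENNReal.ofReal a * ENNReal.ofReal b ≤ ENNReal.ofReal (a * b) := by
  rcases le_total 0 a with ha | ha
  · rw [ENNReal.ofReal_mul ha]
  · simp [ENNReal.ofReal_of_nonpos ha]

theorem theorem5p3 {Ω : Type*} [MeasurableSpace Ω] (P : Measure Ω) [IsProbabilityMeasure P]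
    (m t : ℕ) (hm : 0 < m) (k : Fin m → ℕ) (hk : ∀ i, 0 < k i)
    (S : (i : Fin m) → Fin (k i) → Finset ℕ)
    (hS0 : ∀ i j, 0 ∈ S i j) (hSt : ∀ i j, (S i j).card ≤ t)
    (A B : ℝ) (φ : CoeffIndex S → ℝ → ℝ)
    (hφ : ∀ p, IsConvenientDensity (φ p))
    (hA : ∀ p, ∀ᵐ v : ℝ, φ p v ≤ A) (hB : ∀ p, absMoment (φ p) ≤ B)
    (u : CoeffIndex S → Ω → ℝ) (hu : ∀ p, Measurable (u p))
    (hlaw : ∀ p, P.map (u p) = volume.withDensity (fun v => ENNReal.ofReal (φ p v)))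
    (hindep : iIndepFun u P) :
    Measurable (fun ω => numZerosUnit (sumProdSparse S (fun p => u p ω))) ∧
      ∫⁻ ω, numZerosUnit (sumProdSparse S (fun p => u p ω)) ∂P ≤
        ENNReal.ofReal (A * B * (∑ i, (k i : ℝ)) * ((t : ℝ) - 1)) := by
  have hu' : Measurable fun ω p => u p ω := measurable_pi_lambda _ hu
  have hN : Measurable fun c : CoeffIndex S → ℝ => numZerosUnit (sumProdSparse S c) :=
    measurable_numZerosUnit (continuous_eval_sumProdSparse S)
  refine ⟨hN.comp hu', ?_⟩
  have hprob : ∀ p, IsProbabilityMeasure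
      (volume.withDensity fun v => ENNReal.ofReal (φ p v)) := fun p => (hφ p).isProbabilityMeasure
  have hmap : P.map (fun ω p => u p ω) =
      Measure.pi fun p => volume.withDensity fun v => ENNReal.ofReal (φ p v) := by
    rw [(iIndepFun_iff_map_fun_eq_pi_map fun p => (hu p).aemeasurable).1 hindep]
    simp_rw [hlaw]
  -- Positivity of `m` and `k i` supplies a factor, needed for `F` to be almost surely nonzero at
  -- the endpoints.
  let i : Fin m := ⟨0, hm⟩
  let j : Fin (k i) := ⟨0, hk i⟩
  -- Makes the truncated `t - 1` in `ℕ` agree with the real `t - 1`.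
  have ht : 1 ≤ t := (Finset.card_pos.2 ⟨0, hS0 i j⟩).trans_le (hSt i j)
  have hsum : (∑ i, (k i : ℝ≥0∞)) * ((t - 1 : ℕ) : ℝ≥0∞) =
      ENNReal.ofReal ((∑ i, (k i : ℝ)) * ((t : ℝ) - 1)) := by
    rw [← Nat.cast_sum, ← Nat.cast_sum, ← Nat.cast_pred ht, ← Nat.cast_mul, ← Nat.cast_mul,
      ENNReal.ofReal_natCast]
  calc ∫⁻ ω, numZerosUnit (sumProdSparse S (fun p => u p ω)) ∂P
      = ∫⁻ c, numZerosUnit (sumProdSparse S c) ∂P.map (fun ω p => u p ω) :=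
        (lintegral_map hN hu').symm
    _ ≤ ENNReal.ofReal A * ENNReal.ofReal B * (∑ i, (k i : ℝ≥0∞)) * ((t - 1 : ℕ) : ℝ≥0∞) := by
        rw [hmap]
        exact lintegral_numZerosUnit_sumProdSparse_le hS0 hSt i j
          (fun p => withDensity_ofReal_le_smul (hA p))
          fun p => (hφ p).lintegral_enorm.trans_le (ENNReal.ofReal_le_ofReal (hB p))
    _ ≤ _ := by
        rw [mul_assoc, hsum, mul_assoc (A * B)]
        exact (mul_le_mul_left (ofReal_mul_ofReal_le A B) _).trans (ofReal_mul_ofReal_le _ _)
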